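/- Let $J_0(z) = \sum_{m=0}^{\infty} \frac{(-1)^m}{(m!)^2} \left(\frac{z}{2}\right)^{2m}$, $z \in \mathbb{C}$, be the Bessel function of the first kind of order $0$, and for integers $k \geq 1$ let $\varphi_k = k\pi - \frac{\pi}{4}$. There exists a sequence $(\lambda_k)$ of complex numbers, defined for all sufficiently large integers $k$, such that each $\lambda_k$ is a root of the equation $$(i\lambda - \lambda^2) J_0(\lambda) + \lambda J_0'(\lambda) = 0$$ and $$\lambda_k = \varphi_k + \frac{1}{8\varphi_k} + \frac{\varphi_k}{1+\varphi_k^2} + \frac{i}{1+\varphi_k^2} + O\left(\frac{1}{k^3}\right), \qquad k \to +\infty.$$ -/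

import Mathlib

open Filter Asymptotics

/-- The Bessel function of the first kind of order `n ∈ ℕ`, as the sum of its power series
`J_n(z) = ∑_{m ≥ 0} (-1)^m / (m! (m + n)!) (z / 2)^(2m + n)`, for `z ∈ ℂ`. -/
noncomputable def besselJ (n : ℕ) (z : ℂ) : ℂ :=
  ∑' m : ℕ, (-1 : ℂ) ^ m / ((m.factorial : ℂ) * ((m + n).factorial : ℂ)) * (z / 2) ^ (2 * m + n)

/-- A bound, uniform on the disk of radius `R`, for the terms of the series. -/
theorem norm_besselJ_term_le (n m : ℕ) {R : ℝ} {z : ℂ} (hz : ‖z‖ ≤ R) :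
    ‖(-1 : ℂ) ^ m / ((m.factorial : ℂ) * ((m + n).factorial : ℂ)) * (z / 2) ^ (2 * m + n)‖ ≤
      (R / 2) ^ n * (((R / 2) ^ 2) ^ m / (m.factorial : ℝ)) := by
  have h1 : (1 : ℝ) ≤ ((m + n).factorial : ℝ) := by
    exact_mod_cast Nat.succ_le_of_lt (Nat.factorial_pos _)
  have h0 : (0 : ℝ) < (m.factorial : ℝ) := by exact_mod_cast Nat.factorial_pos _
  have hR : 0 ≤ R := (norm_nonneg z).trans hz
  have hp : (‖z‖ / 2) ^ (2 * m + n) ≤ (R / 2) ^ (2 * m + n) := by gcongr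
  have e : ‖(-1 : ℂ) ^ m / ((m.factorial : ℂ) * ((m + n).factorial : ℂ)) *
      (z / 2) ^ (2 * m + n)‖ =
      1 / ((m.factorial : ℝ) * ((m + n).factorial : ℝ)) * (‖z‖ / 2) ^ (2 * m + n) := by
    simp
  rw [e]
  have hd : 1 / ((m.factorial : ℝ) * ((m + n).factorial : ℝ)) ≤ 1 / (m.factorial : ℝ) := by
    apply one_div_le_one_div_of_le h0
    nlinarith
  calc _ ≤ 1 / (m.factorial : ℝ) * (R / 2) ^ (2 * m + n) := by gcongr
    _ = _ := by rw [pow_add, pow_mul]; ring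

/-- The series that defines `besselJ n z` converges for every `z`. -/
theorem hasSum_besselJ (n : ℕ) (z : ℂ) :
    HasSum (fun m : ℕ => (-1 : ℂ) ^ m / ((m.factorial : ℂ) * ((m + n).factorial : ℂ)) *
      (z / 2) ^ (2 * m + n)) (besselJ n z) :=
  (Summable.of_norm_bounded ((Real.summable_pow_div_factorial _).mul_left _)
    (fun m => norm_besselJ_term_le n m (le_refl ‖z‖))).hasSum

/-- `besselJ n` is entire, so that its `deriv` is the true derivative everywhere. -/
theorem differentiable_besselJ (n : ℕ) : Differentiable ℂ (besselJ n) := by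
  intro z
  have h : DifferentiableOn ℂ (besselJ n) (Metric.ball 0 (‖z‖ + 1)) := by
    apply Complex.differentiableOn_tsum_of_summable_norm
      (u := fun m : ℕ => ((‖z‖ + 1) / 2) ^ n * ((((‖z‖ + 1) / 2) ^ 2) ^ m / (m.factorial : ℝ)))
    · exact (Real.summable_pow_div_factorial _).mul_left _
    · intro m
      fun_prop
    · exact Metric.isOpen_ball
    · intro m w hw
      exact norm_besselJ_term_le n m (mem_ball_zero_iff.mp hw).le
  exact h.differentiableAt (Metric.isOpen_ball.mem_nhds (by simp))

/-!
Since `J₀' = -J₁`, a nonzero `λ` is a root exactly when `J₀ λ / J₁ λ + 1 / (λ - I) = 0`, as long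
as `J₁ λ ≠ 0`. The ratio `r = J₀ / J₁` satisfies the Riccati equation `r' = -1 - r² + r / z`. If
`r φ = 1 / (8 φ) + O(φ⁻³)` at `φ = kπ - π / 4`, then `r` has derivative `-1 + O(φ⁻²)` on a complex
disk of radius of order `1 / φ` about `φ`, and a contraction argument gives a root
`λ = φ + 1 / (8 φ) + 1 / (φ - I) + O(φ⁻³)` (`exists_root_near`); here
`1 / (φ - I) = (φ + I) / (1 + φ²)`. That the ratio stays small on the disk is Grönwall's inequality
for the system satisfied by `J₀` and `J₁` (`besselJ_ratio_bounds`).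

The value of `r φ` requires the asymptotics of `J₀`, including the phase `π / 4`. Let `E` be the
Hankel expansion of a solution `exp (I z) z^(-1/2) (1 + a₁ / z + ⋯)` of Bessel's equation,
truncated after `a₄`. The Wronskian `W = z (J₀ E' - J₀' E)` has derivative
`O(‖z‖⁻⁵)` in the first quadrant, because Poisson's integral gives `‖J₀ z‖ ≤ exp |Im z|`
(`norm_besselJ_zero_le`) and this growth is cancelled by `exp (I z)`. Hence
`W R = W (R I) + O(R⁻⁴)` (`norm_hankelW_sub_le`). On the imaginary axis all factors of `W` are real
except `I^(-1/2)`, so `W (R I)` is a real multiple of `exp (-I π / 4)` (`im_hankelW_mul_I`).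
At `R = φ` this says that
`J₀ φ (φ + O(1 / φ)) + J₁ φ (-1 / 8 + O(1 / φ²))` is `O(φ⁻³)` (`abs_bessel_relation_le`), and
`J₀² + J₁² ≥ c² / x²` (`exists_le_sq_mul_besselJ_sq`) permits division by `J₁ φ`.
-/

/-! ### Differential relations and symmetries of `J₀` and `J₁` -/

theorem hasDerivAt_besselJ_zero (z : ℂ) : HasDerivAt (besselJ 0) (-besselJ 1 z) z := by
  have hz : z ∈ Metric.ball (0 : ℂ) (‖z‖ + 1) := by simp
  have h := Complex.hasSum_deriv_of_summable_norm
    (F := fun (m : ℕ) (z : ℂ) => (-1 : ℂ) ^ m / ((m.factorial : ℂ) * ((m + 0).factorial : ℂ)) *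
      (z / 2) ^ (2 * m + 0))
    ((Real.summable_pow_div_factorial (((‖z‖ + 1) / 2) ^ 2)).mul_left (((‖z‖ + 1) / 2) ^ 0))
    (fun m => by fun_prop) Metric.isOpen_ball
    (fun m w hw => norm_besselJ_term_le 0 m (mem_ball_zero_iff.mp hw).le) hz
  have h1 : HasSum (fun m : ℕ => deriv (fun z : ℂ => (-1 : ℂ) ^ (m + 1) /
      (((m + 1).factorial : ℂ) * ((m + 1 + 0).factorial : ℂ)) *
      (z / 2) ^ (2 * (m + 1) + 0)) z) (-besselJ 1 z) := by
    refine (hasSum_besselJ 1 z).neg.congr_fun ?_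
    intro m
    have hd : HasDerivAt (fun z : ℂ => (-1 : ℂ) ^ (m + 1) / (((m + 1).factorial : ℂ) *
        ((m + 1 + 0).factorial : ℂ)) * (z / 2) ^ (2 * (m + 1) + 0)) _ z :=
      (((hasDerivAt_id z).div_const 2).pow (2 * (m + 1) + 0)).const_mul _
    rw [hd.deriv]
    have := Nat.factorial_ne_zero m
    simp only [add_zero, Nat.factorial_succ, id, show 2 * (m + 1) - 1 = 2 * m + 1 by omega]
    push_cast
    field_simp
    ring
  have h2 := (hasSum_nat_add_iff (f := fun m : ℕ => deriv (fun z : ℂ => (-1 : ℂ) ^ m /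
      ((m.factorial : ℂ) * ((m + 0).factorial : ℂ)) * (z / 2) ^ (2 * m + 0)) z) 1).mp h1
  have e : deriv (besselJ 0) z = -besselJ 1 z := by
    refine h.unique ?_
    simpa using h2
  exact e ▸ (differentiable_besselJ 0 z).hasDerivAt

theorem hasDerivAt_mul_besselJ_one (z : ℂ) :
    HasDerivAt (fun z => z * besselJ 1 z) (z * besselJ 0 z) z := by
  have hz : z ∈ Metric.ball (0 : ℂ) (‖z‖ + 1) := by simp
  have h := Complex.hasSum_deriv_of_summable_norm
    (F := fun (m : ℕ) (z : ℂ) => z * ((-1 : ℂ) ^ m / ((m.factorial : ℂ) *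
      ((m + 1).factorial : ℂ)) * (z / 2) ^ (2 * m + 1)))
    (((Real.summable_pow_div_factorial (((‖z‖ + 1) / 2) ^ 2)).mul_left
      (((‖z‖ + 1) / 2) ^ 1)).mul_left (‖z‖ + 1))
    (fun m => by fun_prop) Metric.isOpen_ball
    (fun m w hw => by
      rw [norm_mul]
      have := (mem_ball_zero_iff.mp hw).le
      exact mul_le_mul this (norm_besselJ_term_le 1 m this) (norm_nonneg _) (by positivity)) hz
  have e0 : (fun z => z * besselJ 1 z) = fun z : ℂ => ∑' m : ℕ, z * ((-1 : ℂ) ^ m /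
      ((m.factorial : ℂ) * ((m + 1).factorial : ℂ)) * (z / 2) ^ (2 * m + 1)) := by
    funext z
    exact ((hasSum_besselJ 1 z).mul_left z).tsum_eq.symm
  have e : deriv (fun z => z * besselJ 1 z) z = z * besselJ 0 z := by
    rw [e0]
    refine h.unique ?_
    refine ((hasSum_besselJ 0 z).mul_left z).congr_fun ?_
    intro m
    have hd : HasDerivAt (fun z : ℂ => z * ((-1 : ℂ) ^ m / ((m.factorial : ℂ) *
        ((m + 1).factorial : ℂ)) * (z / 2) ^ (2 * m + 1))) _ z :=
      (hasDerivAt_id z).mul ((((hasDerivAt_id z).div_const 2).pow (2 * m + 1)).const_mul _)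
    rw [hd.deriv]
    have := Nat.factorial_ne_zero m
    simp only [add_zero, Nat.factorial_succ, id, show 2 * m + 1 - 1 = 2 * m by omega]
    push_cast
    field_simp
    ring
  rw [← e]
  exact (differentiable_id.mul (differentiable_besselJ 1) z).hasDerivAt

theorem hasDerivAt_besselJ_one {z : ℂ} (hz : z ≠ 0) :
    HasDerivAt (besselJ 1) (besselJ 0 z - besselJ 1 z / z) z := by
  have h := (differentiable_besselJ 1 z).hasDerivAt
  have h1 := ((hasDerivAt_id z).mul h).unique (hasDerivAt_mul_besselJ_one z)
  have : deriv (besselJ 1) z = besselJ 0 z - besselJ 1 z / z := by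
    simp at h1
    field_simp
    linear_combination h1
  exact this ▸ h

open ComplexConjugate in
theorem besselJ_conj (n : ℕ) (z : ℂ) : besselJ n (conj z) = conj (besselJ n z) := by
  simp [besselJ, Complex.conj_tsum, map_ofNat]

theorem besselJ_neg (n : ℕ) (z : ℂ) : besselJ n (-z) = (-1) ^ n * besselJ n z := by
  rw [besselJ, besselJ, ← tsum_mul_left]
  congr 1
  ext m
  rw [neg_div, neg_pow (z / 2), pow_add, pow_mul]
  ring_nf

theorem besselJ_zero_zero : besselJ 0 0 = 1 := by
  rw [besselJ, tsum_eq_single 0]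
  · simp
  · intro m hm
    simp [hm]

/-! ### Poisson's integral and the growth of `J₀` -/

theorem integral_sin_pow_even_eq_factorial (m : ℕ) :
    ∫ t in (0 : ℝ)..Real.pi, Real.sin t ^ (2 * m) =
      Real.pi * (2 * m).factorial / (4 ^ m * (m.factorial : ℝ) ^ 2) := by
  rw [integral_sin_pow_even, mul_div_assoc]
  congr 1
  induction m with
  | zero => simp
  | succ m ih =>
    rw [Finset.prod_range_succ, ih, show 2 * (m + 1) = 2 * m + 1 + 1 by ring, Nat.factorial_succ,
      Nat.factorial_succ, Nat.factorial_succ]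
    have := Nat.factorial_ne_zero m
    push_cast
    field_simp
    ring

/-- Poisson's integral for `J₀`, obtained by integrating the cosine series term by term. -/
theorem integral_cos_mul_sin (z : ℂ) :
    ∫ t in (0 : ℝ)..Real.pi, Complex.cos (z * Real.sin t) = Real.pi * besselJ 0 z := by
  have h : HasSum (fun m : ℕ => ∫ t in (0 : ℝ)..Real.pi,
      (-1 : ℂ) ^ m * (z * Real.sin t) ^ (2 * m) / (2 * m).factorial)
      (∫ t in (0 : ℝ)..Real.pi, Complex.cos (z * Real.sin t)) := by
    refine intervalIntegral.hasSum_integral_of_dominated_convergence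
      (fun m _ => ‖z‖ ^ (2 * m) / (2 * m).factorial) ?_ ?_ ?_ ?_ ?_
    · intro m
      exact Continuous.aestronglyMeasurable (by fun_prop)
    · intro m
      refine Eventually.of_forall fun t _ => ?_
      have : |Real.sin t| ^ (2 * m) ≤ 1 := pow_le_one₀ (abs_nonneg _) (Real.abs_sin_le_one t)
      rw [norm_div, norm_mul, norm_pow, norm_pow, norm_mul, mul_pow]
      simp only [norm_neg, norm_one, one_pow, one_mul, Complex.norm_real, Real.norm_eq_abs,
        Complex.norm_natCast]
      gcongr
      exact mul_le_of_le_one_right (by positivity) this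
    · refine Eventually.of_forall fun t _ => ?_
      exact (Real.summable_pow_div_factorial ‖z‖).comp_injective
        (mul_right_injective₀ (two_ne_zero : (2 : ℕ) ≠ 0))
    · exact intervalIntegrable_const
    · exact Eventually.of_forall fun t _ => Complex.hasSum_cos _
  refine h.unique (((hasSum_besselJ 0 z).mul_left (Real.pi : ℂ)).congr_fun ?_)
  intro m
  have e : ∀ t : ℝ, (-1 : ℂ) ^ m * (z * Real.sin t) ^ (2 * m) / (2 * m).factorial =
      ((-1 : ℂ) ^ m * z ^ (2 * m) / (2 * m).factorial) * ((Real.sin t ^ (2 * m) : ℝ) : ℂ) := by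
    intro t
    push_cast
    ring
  simp only [e]
  rw [intervalIntegral.integral_const_mul, intervalIntegral.integral_ofReal,
    integral_sin_pow_even_eq_factorial]
  have h1 := Nat.factorial_ne_zero m
  have h2 := Nat.factorial_ne_zero (2 * m)
  push_cast
  rw [add_zero, add_zero, div_pow, pow_mul 2 2 m]
  norm_num
  field_simp

/-- The growth of `J₀` is exactly cancelled by `exp (I * z)` in the upper half plane, which the
series alone (giving `exp ‖z‖`) would not show. -/
theorem norm_besselJ_zero_le (z : ℂ) : ‖besselJ 0 z‖ ≤ Real.exp |z.im| := by
  have h : ‖∫ t in (0 : ℝ)..Real.pi, Complex.cos (z * Real.sin t)‖ ≤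
      Real.exp |z.im| * |Real.pi - 0| := by
    refine intervalIntegral.norm_integral_le_of_norm_le_const fun t _ => ?_
    have h1 : |(z * Real.sin t).im| ≤ |z.im| := by
      rw [Complex.im_mul_ofReal, abs_mul]
      exact mul_le_of_le_one_right (abs_nonneg _) (Real.abs_sin_le_one t)
    refine le_trans ?_ (Real.exp_le_exp.mpr h1)
    rw [Complex.cos, norm_div, RCLike.norm_ofNat, div_le_iff₀ two_pos]
    refine (norm_add_le _ _).trans ?_
    rw [Complex.norm_exp, Complex.norm_exp, mul_two]
    refine add_le_add (Real.exp_le_exp.mpr ?_) (Real.exp_le_exp.mpr ?_)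
    · rw [Complex.mul_I_re]
      exact neg_le_abs _
    · rw [Complex.mul_I_re, Complex.neg_im, neg_neg]
      exact le_abs_self _
  rw [integral_cos_mul_sin, norm_mul, Complex.norm_real, Real.norm_eq_abs, sub_zero,
    abs_of_pos Real.pi_pos, mul_comm] at h
  exact le_of_mul_le_mul_right h Real.pi_pos

/-! ### The Wronskian of `J₀` with a truncated Hankel expansion -/

/-- The Hankel expansion in powers of `1 / z` of the amplitude of a solution
`exp (I z) z^(-1/2) (1 + a₁ / z + a₂ / z² + ⋯)` of Bessel's equation of order `0`, truncated after
`z⁻⁴`; the coefficients obey `2 I (n + 1) aₙ₊₁ = (n + 1/2)² aₙ`. -/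
noncomputable def hankelP (z : ℂ) : ℂ :=
  1 - Complex.I / 8 * z⁻¹ - 9 / 128 * z⁻¹ ^ 2 + 75 * Complex.I / 1024 * z⁻¹ ^ 3 +
    3675 / 32768 * z⁻¹ ^ 4

/-- With `E z = exp (I z) z^(-1/2) hankelP z`, the function `hankelQ` is defined by
`z * E' z = exp (I z) z^(-1/2) hankelQ z`, written out explicitly. -/
noncomputable def hankelQ (z : ℂ) : ℂ :=
  Complex.I * z * hankelP z - 1 / 2 + 3 * Complex.I / 16 * z⁻¹ + 45 / 256 * z⁻¹ ^ 2 -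
    525 * Complex.I / 2048 * z⁻¹ ^ 3 - 33075 / 65536 * z⁻¹ ^ 4

/-- The Wronskian `z (J₀ E' - J₀' E)` of `J₀` with the approximate solution
`E z = exp (I z) z^(-1/2) hankelP z`; the power is the principal branch. -/
noncomputable def hankelW (z : ℂ) : ℂ :=
  Complex.exp (Complex.I * z) * z ^ (-1 / 2 : ℂ) *
    (besselJ 0 z * hankelQ z + z * besselJ 1 z * hankelP z)

theorem hasDerivAt_hankelP {z : ℂ} (hz : z ≠ 0) :
    HasDerivAt hankelP (Complex.I / 8 * z⁻¹ ^ 2 + 9 / 64 * z⁻¹ ^ 3 -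
      225 * Complex.I / 1024 * z⁻¹ ^ 4 - 3675 / 8192 * z⁻¹ ^ 5) z := by
  have h := hasDerivAt_inv hz
  have hd : HasDerivAt hankelP _ z :=
    ((((h.const_mul (Complex.I / 8)).const_sub 1).sub ((h.pow 2).const_mul (9 / 128))).add
      ((h.pow 3).const_mul (75 * Complex.I / 1024))).add ((h.pow 4).const_mul (3675 / 32768))
  refine hd.congr_deriv ?_
  push_cast
  field_simp
  ring

/-- For an exact solution the Wronskian would be constant; what remains comes from the first
neglected term of the expansion. -/
theorem hasDerivAt_hankelW {z : ℂ} (hz : z ∈ Complex.slitPlane) :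
    HasDerivAt hankelW (297675 / 131072 * (Complex.exp (Complex.I * z) * z ^ (-1 / 2 : ℂ) *
      (besselJ 0 z * z⁻¹ ^ 5))) z := by
  have h0 : z ≠ 0 := Complex.slitPlane_ne_zero hz
  have h := hasDerivAt_inv h0
  have hP := hasDerivAt_hankelP h0
  have hQ : HasDerivAt hankelQ _ z :=
    ((((((hasDerivAt_id z).const_mul Complex.I).mul hP).sub_const (1 / 2)).add
      (h.const_mul (3 * Complex.I / 16))).add ((h.pow 2).const_mul (45 / 256))).sub
      ((h.pow 3).const_mul (525 * Complex.I / 2048)) |>.sub ((h.pow 4).const_mul (33075 / 65536))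
  have hS : HasDerivAt (fun z : ℂ => z ^ (-1 / 2 : ℂ)) (-1 / 2 * (z ^ (-1 / 2 : ℂ) * z⁻¹)) z := by
    refine ((hasDerivAt_id z).cpow_const (c := (-1 / 2 : ℂ)) hz).congr_deriv ?_
    rw [id, Complex.cpow_sub _ _ h0, Complex.cpow_one, div_eq_mul_inv _ z, mul_one]
  have hW : HasDerivAt hankelW _ z :=
    (((hasDerivAt_id z).const_mul Complex.I).cexp.mul hS).mul
    (((hasDerivAt_besselJ_zero z).mul hQ).add
    (((hasDerivAt_id z).mul (hasDerivAt_besselJ_one h0)).mul hP))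
  refine hW.congr_deriv ?_
  simp only [id, Pi.mul_apply, hankelQ, hankelP]
  generalize z ^ (-1 / 2 : ℂ) = S
  generalize Complex.exp (Complex.I * z) = E
  generalize besselJ 0 z = A
  generalize besselJ 1 z = B
  push_cast
  field_simp
  ring_nf
  simp only [Complex.I_sq, Complex.I_pow_three]
  ring

theorem norm_deriv_hankelW_le {R : ℝ} (hR : 2 ≤ R) {z : ℂ} (him : 0 ≤ z.im)
    (hz : R ≤ z.re + z.im) :
    ‖297675 / 131072 * (Complex.exp (Complex.I * z) * z ^ (-1 / 2 : ℂ) *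
      (besselJ 0 z * z⁻¹ ^ 5))‖ ≤ 73 / R ^ 5 := by
  have hn : R / 2 ≤ ‖z‖ := by
    have h1 := Complex.re_le_norm z
    have h2 := Complex.im_le_norm z
    linarith
  have h0 : z ≠ 0 := norm_pos_iff.mp (by linarith)
  have hS : ‖z ^ (-1 / 2 : ℂ)‖ ≤ 1 := by
    rw [Complex.norm_cpow_of_ne_zero h0]
    have e1 : (-1 / 2 : ℂ).im = 0 := by norm_num
    have e2 : (-1 / 2 : ℂ).re = -1 / 2 := by norm_num
    rw [e1, e2, mul_zero, Real.exp_zero, div_one]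
    exact Real.rpow_le_one_of_one_le_of_nonpos (by linarith) (by norm_num)
  -- The decay of `exp (I z)` exactly compensates the growth of `J₀`.
  have hEJ : ‖Complex.exp (Complex.I * z)‖ * ‖besselJ 0 z‖ ≤ 1 := by
    calc _ ≤ Real.exp (-z.im) * Real.exp z.im := by
          refine mul_le_mul ?_ ?_ (norm_nonneg _) (Real.exp_nonneg _)
          · rw [Complex.norm_exp, Complex.I_mul_re]
          · simpa [abs_of_nonneg him] using norm_besselJ_zero_le z
      _ = 1 := by rw [← Real.exp_add]; simp
  have hi : ‖z‖⁻¹ ^ 5 ≤ 32 / R ^ 5 := by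
    have : ‖z‖⁻¹ ≤ (R / 2)⁻¹ := inv_anti₀ (by linarith) hn
    calc ‖z‖⁻¹ ^ 5 ≤ (R / 2)⁻¹ ^ 5 := by gcongr
      _ = 32 / R ^ 5 := by field_simp; norm_num
  calc _ = 297675 / 131072 * ((‖Complex.exp (Complex.I * z)‖ * ‖besselJ 0 z‖) *
        ‖z ^ (-1 / 2 : ℂ)‖ * ‖z‖⁻¹ ^ 5) := by
        simp only [norm_mul, norm_div, norm_pow, norm_inv, RCLike.norm_ofNat]
        ring
    _ ≤ 297675 / 131072 * (1 * 1 * (32 / R ^ 5)) := by gcongr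
    _ ≤ 73 / R ^ 5 := by
        rw [show 297675 / 131072 * (1 * 1 * (32 / R ^ 5)) = (297675 / 4096) / R ^ 5 by ring]
        gcongr
        norm_num

/-- The Wronskian barely changes between `R` and `R * I`. The mean value inequality is applied on
the convex part of the closed first quadrant cut off by the segment from `R` to `R * I`. -/
theorem norm_hankelW_sub_le {R : ℝ} (hR : 2 ≤ R) :
    ‖hankelW R - hankelW (R * Complex.I)‖ ≤ 146 / R ^ 4 := by
  have hconv : Convex ℝ {z : ℂ | 0 ≤ z.re ∧ 0 ≤ z.im ∧ R ≤ z.re + z.im} := by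
    intro x hx y hy a b ha hb hab
    obtain ⟨hx1, hx2, hx3⟩ := hx
    obtain ⟨hy1, hy2, hy3⟩ := hy
    simp only [Set.mem_ofPred_eq, Complex.add_re, Complex.add_im, Complex.real_smul,
      Complex.re_ofReal_mul, Complex.im_ofReal_mul]
    refine ⟨by positivity, by positivity, ?_⟩
    nlinarith [mul_le_mul_of_nonneg_left hx3 ha, mul_le_mul_of_nonneg_left hy3 hb]
  have h := hconv.norm_image_sub_le_of_norm_hasDerivWithin_le (f := hankelW)
    (x := R * Complex.I) (y := R)
    (fun z hz => (hasDerivAt_hankelW (Complex.mem_slitPlane_iff.mpr ?_)).hasDerivWithinAt)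
    (fun z hz => norm_deriv_hankelW_le hR hz.2.1 hz.2.2) (by simp; linarith)
    (by simp; linarith)
  · refine h.trans ?_
    have : ‖(R : ℂ) - R * Complex.I‖ ≤ 2 * R := by
      refine (norm_sub_le _ _).trans ?_
      simp [abs_of_nonneg (show 0 ≤ R by linarith)]
      linarith
    calc _ ≤ 73 / R ^ 5 * (2 * R) := by gcongr
      _ = 146 / R ^ 4 := by field_simp; norm_num
  · obtain ⟨h1, h2, h3⟩ := hz
    rcases h1.lt_or_eq with h | h
    · exact Or.inl h
    · exact Or.inr (by intro h4; linarith)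

open ComplexConjugate in
/-- The last factor of `hankelW` carries the reflection `z ↦ -conj z` in the imaginary axis to
conjugation, so it is real on that axis. -/
theorem conj_besselJ_hankel_bracket (z : ℂ) :
    conj (besselJ 0 z * hankelQ z + z * besselJ 1 z * hankelP z) =
      besselJ 0 (-conj z) * hankelQ (-conj z) +
        -conj z * besselJ 1 (-conj z) * hankelP (-conj z) := by
  have hP : conj (hankelP z) = hankelP (-conj z) := by
    simp [hankelP, map_ofNat]
    ring
  have hQ : conj (hankelQ z) = hankelQ (-conj z) := by
    simp [hankelQ, ← hP, map_ofNat]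
    ring
  rw [besselJ_neg, besselJ_neg, besselJ_conj, besselJ_conj, ← hP, ← hQ]
  simp

/-- On the imaginary axis the Wronskian has the phase `-π / 4` of `I^(-1/2)`. This is where the
constant `π / 4` in the asymptotics of `J₀` comes from. -/
theorem im_hankelW_mul_I {R : ℝ} (hR : 0 < R) :
    (hankelW (R * Complex.I) * Complex.exp (Real.pi / 4 * Complex.I)).im = 0 := by
  have hc := conj_besselJ_hankel_bracket (R * Complex.I)
  have e : -(starRingEnd ℂ) (R * Complex.I) = R * Complex.I := by simp
  rw [e, Complex.conj_eq_iff_real] at hc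
  obtain ⟨b, hb⟩ := hc
  have hS : ((R : ℂ) * Complex.I) ^ (-1 / 2 : ℂ) * Complex.exp (Real.pi / 4 * Complex.I) =
      (Real.exp (-Real.log R / 2) : ℝ) := by
    rw [Complex.cpow_def_of_ne_zero (by simp [hR.ne']), Complex.log_ofReal_mul hR Complex.I_ne_zero,
      Complex.log_I, ← Complex.exp_add]
    push_cast
    congr 1
    ring
  have hE : Complex.exp (Complex.I * (R * Complex.I)) = (Real.exp (-R) : ℝ) := by
    push_cast
    congr 1
    linear_combination (R : ℂ) * Complex.I_mul_I
  rw [hankelW, hb, mul_right_comm, mul_assoc (Complex.exp _), hS, hE]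
  norm_cast

theorem abs_im_hankelW_le {R : ℝ} (hR : 2 ≤ R) :
    |(hankelW R * Complex.exp (Real.pi / 4 * Complex.I)).im| ≤ 146 / R ^ 4 := by
  have h := norm_hankelW_sub_le hR
  have h1 : (hankelW R * Complex.exp (Real.pi / 4 * Complex.I)).im =
      ((hankelW R - hankelW (R * Complex.I)) * Complex.exp (Real.pi / 4 * Complex.I)).im := by
    rw [sub_mul, Complex.sub_im, im_hankelW_mul_I (by linarith), sub_zero]
  have h2 : ‖Complex.exp (Real.pi / 4 * Complex.I)‖ = 1 := by
    simpa using Complex.norm_exp_ofReal_mul_I (Real.pi / 4)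
  rw [h1]
  refine (Complex.abs_im_le_norm _).trans ?_
  rwa [norm_mul, h2, mul_one]

theorem besselJ_ofReal (n : ℕ) (x : ℝ) : ((besselJ n x).re : ℂ) = besselJ n x := by
  rw [← Complex.conj_eq_iff_re, ← besselJ_conj, Complex.conj_ofReal]

theorem im_besselJ_hankel_bracket_ofReal {x : ℝ} (hx : x ≠ 0) :
    (besselJ 0 x * hankelQ x + x * besselJ 1 x * hankelP x).im =
      (besselJ 0 x).re * (x + 15 / 128 / x - 4725 / 32768 / x ^ 3) +
        (besselJ 1 x).re * (-1 / 8 + 75 / 1024 / x ^ 2) := by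
  rw [← besselJ_ofReal 0, ← besselJ_ofReal 1]
  generalize (besselJ 0 x).re = a
  generalize (besselJ 1 x).re = b
  have hx' : (x : ℂ) ≠ 0 := Complex.ofReal_ne_zero.mpr hx
  have h : (a : ℂ) * hankelQ x + x * b * hankelP x =
      ((a * (-1 / 2 + 1 / 8 + (45 / 256 - 75 / 1024) / x ^ 2 - 33075 / 65536 / x ^ 4) +
        x * b * (1 - 9 / 128 / x ^ 2 + 3675 / 32768 / x ^ 4) : ℝ) : ℂ) +
      ((a * (x + 15 / 128 / x - 4725 / 32768 / x ^ 3) + b * (-1 / 8 + 75 / 1024 / x ^ 2) : ℝ) : ℂ) *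
        Complex.I := by
    rw [hankelQ, hankelP]
    push_cast
    field_simp
    ring_nf
    simp only [Complex.I_sq]
    ring
  rw [h]
  simp [-Complex.ofReal_add, -Complex.ofReal_mul]
  try norm_cast

/-- At `x = kπ - π / 4` the factor `exp (I x) exp (I π / 4)` is `±1`, so the known phase of the
Wronskian is a real linear relation between `J₀ x` and `J₁ x`. -/
theorem abs_bessel_relation_le {k : ℕ} {x : ℝ} (hx : x = k * Real.pi - Real.pi / 4) (h2 : 2 ≤ x) :
    |(besselJ 0 x).re * (x + 15 / 128 / x - 4725 / 32768 / x ^ 3) +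
        (besselJ 1 x).re * (-1 / 8 + 75 / 1024 / x ^ 2)| ≤ 146 / x ^ 3 := by
  have h := abs_im_hankelW_le h2
  have hE : Complex.exp (Complex.I * x) * Complex.exp (Real.pi / 4 * Complex.I) =
      ((-1) ^ k : ℝ) := by
    rw [← Complex.exp_add, hx]
    push_cast
    rw [← Complex.exp_pi_mul_I, ← Complex.exp_nat_mul]
    congr 1
    ring
  have hS : (x : ℂ) ^ (-1 / 2 : ℂ) = ((x ^ (-1 / 2 : ℝ) : ℝ) : ℂ) := by
    rw [Complex.ofReal_cpow (by linarith)]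
    norm_num
  -- A crude bound suffices: half a power of `x` is given away here.
  have hS1 : x⁻¹ ≤ x ^ (-1 / 2 : ℝ) := by
    rw [← Real.rpow_neg_one]
    exact Real.rpow_le_rpow_of_exponent_le (by linarith) (by norm_num)
  rw [← im_besselJ_hankel_bracket_ofReal (by linarith)]
  have e : hankelW x * Complex.exp (Real.pi / 4 * Complex.I) =
      ((((-1) ^ k * x ^ (-1 / 2 : ℝ)) : ℝ) : ℂ) *
        (besselJ 0 x * hankelQ x + x * besselJ 1 x * hankelP x) := by
    rw [hankelW, mul_right_comm, mul_right_comm (Complex.exp _), hE, hS, Complex.ofReal_mul]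
  rw [e, Complex.im_ofReal_mul, abs_mul, abs_mul, abs_pow, abs_neg, abs_one, one_pow, one_mul,
    abs_of_nonneg (Real.rpow_nonneg (by linarith) _)] at h
  have h3 := (mul_le_mul_of_nonneg_right hS1 (abs_nonneg _)).trans h
  have hx0 : 0 < x := by linarith
  rw [inv_mul_le_iff₀ hx0] at h3
  refine h3.trans (le_of_eq ?_)
  field_simp

/-! ### The ratio `J₀ / J₁` at `kπ - π / 4` -/

/-- `J₀` and `J₁` are not simultaneously small: `x² (J₀² + J₁²)` has derivative `2 x J₀²`. The
resulting lower bound is weaker than the true order `1 / x` of `J₀² + J₁²`, but the extra terms in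
`hankelP` make up for it. -/
theorem exists_le_sq_mul_besselJ_sq :
    ∃ c : ℝ, 0 < c ∧ ∀ x : ℝ, 1 ≤ x →
      c ^ 2 ≤ x ^ 2 * ((besselJ 0 x).re ^ 2 + (besselJ 1 x).re ^ 2) := by
  have hd : ∀ x : ℝ, 0 < x → HasDerivAt
      (fun x : ℝ => x ^ 2 * ((besselJ 0 x).re ^ 2 + (besselJ 1 x).re ^ 2))
      (2 * x * (besselJ 0 x).re ^ 2) x := by
    intro x hx
    have hx' : (x : ℂ) ≠ 0 := Complex.ofReal_ne_zero.mpr hx.ne'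
    have h0 := (hasDerivAt_besselJ_zero x).real_of_complex
    have h1 := (hasDerivAt_besselJ_one hx').real_of_complex
    have h : HasDerivAt
      (fun x : ℝ => x ^ 2 * ((besselJ 0 x).re ^ 2 + (besselJ 1 x).re ^ 2)) _ x :=
      ((hasDerivAt_id x).pow 2).mul ((h0.pow 2).add (h1.pow 2))
    refine h.congr_deriv ?_
    simp only [Complex.neg_re, Complex.sub_re, Complex.div_ofReal_re, Pi.pow_apply, id]
    push_cast
    field_simp
    ring
  have hmono : MonotoneOn (fun x : ℝ => x ^ 2 * ((besselJ 0 x).re ^ 2 + (besselJ 1 x).re ^ 2))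
      (Set.Ioi 0) := by
    refine monotoneOn_of_deriv_nonneg (convex_Ioi 0)
      (fun x hx => (hd x hx).continuousAt.continuousWithinAt)
      (fun x hx => (hd x (interior_subset hx)).differentiableAt.differentiableWithinAt) ?_
    intro x hx
    rw [interior_Ioi] at hx
    rw [(hd x hx).deriv]
    have : 0 < x := hx
    positivity
  have hcont : Continuous fun x : ℝ => besselJ 0 (x : ℂ) :=
    (differentiable_besselJ 0).continuous.comp Complex.continuous_ofReal
  -- Since `J₀ 0 = 1`, the increasing quantity is positive at some small `y > 0`.
  have hev : ∀ᶠ x : ℝ in nhds 0, besselJ 0 (x : ℂ) ≠ 0 := by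
    refine hcont.continuousAt.eventually_ne ?_
    rw [Complex.ofReal_zero, besselJ_zero_zero]
    exact one_ne_zero
  obtain ⟨δ, hδ, hball⟩ := Metric.eventually_nhds_iff.mp hev
  obtain ⟨y, hy0, hy⟩ := exists_between (lt_min hδ one_pos)
  have hJ : (besselJ 0 (y : ℂ)).re ≠ 0 := by
    intro h
    have h1 := hball (y := y) (by
      rw [Real.dist_eq, sub_zero, abs_of_pos hy0]; exact hy.trans_le (min_le_left _ _))
    rw [← besselJ_ofReal, h] at h1
    exact h1 Complex.ofReal_zero
  refine ⟨y * |(besselJ 0 (y : ℂ)).re|, by positivity, fun x hx => ?_⟩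
  have h1 : y ≤ x := (hy.trans_le (min_le_right _ _)).le.trans hx
  refine le_trans ?_ (hmono hy0 (hy0.trans_le h1 : (0 : ℝ) < x) h1)
  rw [mul_pow, sq_abs]
  exact mul_le_mul_of_nonneg_left (le_add_of_nonneg_right (sq_nonneg _)) (sq_nonneg y)

/-- The elementary estimate by which the relation between `a = J₀ x` and `b = J₁ x`, together with
the lower bound on `a² + b²`, gives `a / b = 1 / (8 x) + O(1 / x³)`. -/
theorem abs_div_sub_le_of_relation {a b c x : ℝ} (hc : 0 < c) (hx : 2 ≤ x)
    (hxc : 584 / c ≤ x ^ 2) (hlow : c ^ 2 ≤ x ^ 2 * (a ^ 2 + b ^ 2))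
    (h : |a * (x + 15 / 128 / x - 4725 / 32768 / x ^ 3) + b * (-1 / 8 + 75 / 1024 / x ^ 2)| ≤
      146 / x ^ 3) :
    b ≠ 0 ∧ |a / b - 1 / (8 * x)| ≤ (2000 / c + 2) / x ^ 3 := by
  have hx0 : 0 < x := by linarith
  obtain ⟨t, ht⟩ : ∃ t, t = -1 / 8 + 75 / 1024 / x ^ 2 := ⟨_, rfl⟩
  obtain ⟨s, hs⟩ : ∃ s, s = x + 15 / 128 / x - 4725 / 32768 / x ^ 3 := ⟨_, rfl⟩
  rw [← ht, ← hs] at h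
  have hx2 : 1 / x ^ 2 ≤ 1 / 4 := one_div_le_one_div_of_le (by norm_num) (by nlinarith)
  have hx2' : 0 < 1 / x ^ 2 := by positivity
  have ht1 : |t + 1 / 8| ≤ 1 / 8 / x ^ 2 := by
    have e : t + 1 / 8 = 75 / 1024 * (1 / x ^ 2) := by rw [ht]; ring
    rw [e, abs_of_pos (by positivity), div_eq_mul_one_div (1 / 8) (x ^ 2)]
    exact mul_le_mul_of_nonneg_right (by norm_num) hx2'.le
  have ht2 : |t| ≤ 1 / 8 := by
    have e : t = -1 / 8 + 75 / 1024 * (1 / x ^ 2) := by rw [ht]; ring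
    rw [abs_le]
    constructor <;> linarith
  have hs1 : |s - x| ≤ 1 / 8 / x := by
    have e : s - x = (15 / 128 - 4725 / 32768 * (1 / x ^ 2)) / x := by
      rw [hs]; field_simp; ring
    rw [e, abs_div, abs_of_pos hx0]
    gcongr
    rw [abs_le]
    constructor <;> linarith
  have hs2 : x / 2 ≤ s := by
    have h1 : 1 / 8 / x ≤ 1 / 8 / 2 := by gcongr
    have := (abs_le.mp hs1).1
    linarith
  have hs0 : 0 < s := by linarith
  have h3 : 146 / x ^ 3 ≤ c / (4 * x) := by
    rw [div_le_iff₀ hc] at hxc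
    rw [div_le_div_iff₀ (by positivity) (by positivity)]
    nlinarith
  -- If `b` were smaller than this, the relation would make `a` small too, against `hlow`.
  have hb : c / (4 * x) ≤ |b| := by
    by_contra! hlt
    have ha : |a| ≤ c / (4 * x) + c / (4 * x) := by
      calc |a| ≤ |a| * s := le_mul_of_one_le_right (abs_nonneg _) (by linarith)
        _ = |(a * s + b * t) - b * t| := by rw [add_sub_cancel_right, abs_mul, abs_of_pos hs0]
        _ ≤ |a * s + b * t| + |b * t| := abs_sub _ _
        _ ≤ c / (4 * x) + c / (4 * x) := by
          refine add_le_add (h.trans h3) ?_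
          rw [abs_mul]
          calc |b| * |t| ≤ |b| * 1 := by gcongr; linarith
            _ ≤ c / (4 * x) := by linarith
    have h5 : x ^ 2 * (a ^ 2 + b ^ 2) ≤ x ^ 2 * ((c / (4 * x) + c / (4 * x)) ^ 2 +
        (c / (4 * x)) ^ 2) := by
      rw [← sq_abs a, ← sq_abs b]
      gcongr
    have h6 : x ^ 2 * ((c / (4 * x) + c / (4 * x)) ^ 2 + (c / (4 * x)) ^ 2) = 5 / 16 * c ^ 2 := by
      field_simp
      norm_num
    nlinarith [sq_pos_of_pos hc]
  have hb0 : 0 < |b| := lt_of_lt_of_le (by positivity) hb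
  have hbne : b ≠ 0 := abs_pos.mp hb0
  refine ⟨hbne, ?_⟩
  obtain ⟨r, hr⟩ : ∃ r, r = a / b := ⟨_, rfl⟩
  have h7 : |r * s + t| ≤ 584 / c / x ^ 2 := by
    have e : r * s + t = (a * s + b * t) / b := by rw [hr]; field_simp
    rw [e, abs_div]
    calc _ ≤ 146 / x ^ 3 / (c / (4 * x)) := by gcongr
      _ = 584 / c / x ^ 2 := by field_simp; norm_num
  have h8 : |r| ≤ (584 / c + 1 / 8) * 2 / x := by
    have h9 : |r| * s ≤ 584 / c + 1 / 8 := by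
      calc |r| * s = |(r * s + t) - t| := by rw [add_sub_cancel_right, abs_mul, abs_of_pos hs0]
        _ ≤ |r * s + t| + |t| := abs_sub _ _
        _ ≤ 584 / c / x ^ 2 + 1 / 8 := add_le_add h7 ht2
        _ ≤ 584 / c + 1 / 8 := by
          exact add_le_add_left (div_le_self (by positivity) (by nlinarith)) _
    rw [le_div_iff₀ hx0]
    nlinarith [abs_nonneg r]
  rw [← hr]
  have e : r - 1 / (8 * x) = ((r * s + t) - (t + 1 / 8) - r * (s - x)) / x := by
    field_simp
    ring
  rw [e, abs_div, abs_of_pos hx0, div_le_iff₀ hx0]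
  calc _ ≤ |r * s + t| + |t + 1 / 8| + |r| * |s - x| := by
        rw [← abs_mul]
        exact (abs_sub _ _).trans (add_le_add_left (abs_sub _ _) _)
    _ ≤ 584 / c / x ^ 2 + 1 / 8 / x ^ 2 + (584 / c + 1 / 8) * 2 / x * (1 / 8 / x) := by gcongr
    _ = (730 / c + 5 / 32) / x ^ 2 := by field_simp; ring
    _ ≤ (2000 / c + 2) / x ^ 2 := by gcongr <;> norm_num
    _ = (2000 / c + 2) / x ^ 3 * x := by field_simp

/-! ### The ratio `J₀ / J₁` on a complex disk -/

/-- Grönwall's inequality for the system `J₀' = -J₁`, `J₁' = J₀ - J₁ / z` along the segment from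
`x` to `x + h`. The bound is relative to the size at `x`, which itself tends to `0`. -/
theorem norm_besselJ_le_exp_mul {x : ℝ} {h : ℂ} (hx : 2 ≤ x) (hh : ‖h‖ ≤ 1) {M : ℝ}
    (h0 : ‖besselJ 0 x‖ ≤ M) (h1 : ‖besselJ 1 x‖ ≤ M) :
    ‖besselJ 0 (x + h)‖ ≤ M * Real.exp (2 * ‖h‖) ∧
      ‖besselJ 1 (x + h)‖ ≤ M * Real.exp (2 * ‖h‖) := by
  have hz : ∀ t : ℝ, 0 ≤ t → t ≤ 1 → 1 ≤ ‖(x : ℂ) + t * h‖ := by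
    intro t ht0 ht1
    have h2 := norm_sub_le_norm_add (x : ℂ) (t * h)
    rw [norm_mul, Complex.norm_real, Complex.norm_real, Real.norm_of_nonneg ht0,
      Real.norm_of_nonneg (by linarith : 0 ≤ x)] at h2
    nlinarith [norm_nonneg h]
  have hline : ∀ t : ℝ, HasDerivAt (fun t : ℝ => (x : ℂ) + t * h) h t := by
    intro t
    simpa using (((hasDerivAt_id t).ofReal_comp).mul_const h).const_add (x : ℂ)
  have hcont : Continuous fun t : ℝ => (x : ℂ) + t * h := by fun_prop
  have key := norm_le_gronwallBound_of_norm_deriv_right_le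
    (f := fun t : ℝ => (besselJ 0 ((x : ℂ) + t * h), besselJ 1 ((x : ℂ) + t * h)))
    (f' := fun t : ℝ => (-besselJ 1 ((x : ℂ) + t * h) * h, (besselJ 0 ((x : ℂ) + t * h) -
      besselJ 1 ((x : ℂ) + t * h) / ((x : ℂ) + t * h)) * h))
    (δ := M) (K := 2 * ‖h‖) (ε := 0) (a := 0) (b := 1)
    (((differentiable_besselJ 0).continuous.comp hcont).prodMk
      ((differentiable_besselJ 1).continuous.comp hcont)).continuousOn
    (fun t ht => by
      have hne : (x : ℂ) + t * h ≠ 0 :=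
        norm_pos_iff.mp (zero_lt_one.trans_le (hz t ht.1 ht.2.le))
      exact (((hasDerivAt_besselJ_zero _).comp t (hline t)).prodMk
        ((hasDerivAt_besselJ_one hne).comp t (hline t))).hasDerivWithinAt)
    (by simp [Prod.norm_def, h0, h1])
    (fun t ht => by
      have h3 := hz t ht.1 ht.2.le
      rw [Prod.norm_def, Prod.norm_def, add_zero]
      simp only [norm_mul, norm_neg]
      generalize besselJ 0 ((x : ℂ) + t * h) = A
      generalize besselJ 1 ((x : ℂ) + t * h) = B
      have h4 : ‖A - B / ((x : ℂ) + t * h)‖ ≤ ‖A‖ + ‖B‖ := by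
        refine (norm_sub_le _ _).trans (add_le_add le_rfl ?_)
        rw [norm_div]
        exact div_le_self (norm_nonneg _) h3
      have h5 := le_max_left ‖A‖ ‖B‖
      have h6 := le_max_right ‖A‖ ‖B‖
      have h7 := norm_nonneg h
      have h8 := norm_nonneg A
      refine max_le ?_ ?_ <;> nlinarith)
    1 (by simp)
  rw [gronwallBound_ε0, Prod.norm_def] at key
  simp only [Complex.ofReal_one, one_mul, sub_zero, mul_one] at key
  exact ⟨(le_max_left _ _).trans key, (le_max_right _ _).trans key⟩

/-- On a disk of fixed radius about `x`, `J₁` stays above half of its value at the center. -/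
theorem besselJ_ratio_bounds {x : ℝ} (hx : 2 ≤ x) (h1 : besselJ 1 x ≠ 0)
    (hr : ‖besselJ 0 x / besselJ 1 x‖ ≤ 1) {h : ℂ} (hh : ‖h‖ ≤ 1 / 8) :
    besselJ 1 (x + h) ≠ 0 ∧ ‖besselJ 0 (x + h) / besselJ 1 (x + h)‖ ≤
      2 * ‖besselJ 0 x / besselJ 1 x‖ + 4 * ‖h‖ := by
  obtain ⟨M, hM⟩ : ∃ M, M = ‖besselJ 1 (x : ℂ)‖ := ⟨_, rfl⟩
  have hM0 : 0 < M := hM ▸ norm_pos_iff.mpr h1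
  have h0 : ‖besselJ 0 (x : ℂ)‖ = ‖besselJ 0 x / besselJ 1 x‖ * M := by
    rw [hM, norm_div, div_mul_cancel₀ _ (norm_ne_zero_iff.mpr h1)]
  have hexp : Real.exp (2 * (1 / 8)) ≤ 4 / 3 := by
    rw [← Real.le_log_iff_exp_le (by norm_num)]
    have := Real.one_sub_inv_le_log_of_pos (show (0 : ℝ) < 4 / 3 by norm_num)
    linarith
  have hb : ∀ z ∈ Metric.closedBall (x : ℂ) (1 / 8),
      z ≠ 0 ∧ ‖besselJ 0 z‖ ≤ 4 / 3 * M ∧ ‖besselJ 1 z‖ ≤ 4 / 3 * M ∧ 3 / 2 ≤ ‖z‖ := by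
    intro z hz
    rw [mem_closedBall_iff_norm] at hz
    have h2 := norm_besselJ_le_exp_mul (h := z - x) hx (by linarith) (M := M)
      (by rw [h0]; exact mul_le_of_le_one_left hM0.le hr) hM.ge
    rw [add_sub_cancel] at h2
    have h3 : M * Real.exp (2 * ‖z - x‖) ≤ 4 / 3 * M := by
      rw [mul_comm]
      gcongr
      exact le_trans (by gcongr) hexp
    have h4 : x - 1 / 8 ≤ ‖z‖ := by
      have := norm_sub_norm_le (x : ℂ) z
      rw [norm_sub_rev, Complex.norm_real, Real.norm_of_nonneg (by linarith)] at this
      linarith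
    exact ⟨norm_pos_iff.mp (by linarith), h2.1.trans h3, h2.2.trans h3, by linarith⟩
  have hxm : (x : ℂ) ∈ Metric.closedBall (x : ℂ) (1 / 8) := by simp
  have hhm : (x : ℂ) + h ∈ Metric.closedBall (x : ℂ) (1 / 8) := by simpa using hh
  have d0 := (convex_closedBall (x : ℂ) (1 / 8)).norm_image_sub_le_of_norm_hasDerivWithin_le
    (C := 2 * M) (fun z _ => (hasDerivAt_besselJ_zero z).hasDerivWithinAt)
    (fun z hz => by rw [norm_neg]; linarith [(hb z hz).2.2.1]) hxm hhm
  have d1 := (convex_closedBall (x : ℂ) (1 / 8)).norm_image_sub_le_of_norm_hasDerivWithin_le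
    (C := 4 * M) (fun z hz => (hasDerivAt_besselJ_one (hb z hz).1).hasDerivWithinAt)
    (fun z hz => by
      obtain ⟨_, ha, hb, hz⟩ := hb z hz
      refine (norm_sub_le _ _).trans ?_
      rw [norm_div]
      have : ‖besselJ 1 z‖ / ‖z‖ ≤ ‖besselJ 1 z‖ := div_le_self (norm_nonneg _) (by linarith)
      linarith) hxm hhm
  rw [add_sub_cancel_left] at d0 d1
  have e1 : M / 2 ≤ ‖besselJ 1 (x + h)‖ := by
    have := norm_sub_norm_le (besselJ 1 (x : ℂ)) (besselJ 1 (x + h))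
    rw [norm_sub_rev, ← hM] at this
    nlinarith
  have e0 : ‖besselJ 0 (x + h)‖ ≤ ‖besselJ 0 x / besselJ 1 x‖ * M + 2 * M * ‖h‖ := by
    have := norm_sub_norm_le (besselJ 0 (x + h)) (besselJ 0 (x : ℂ))
    rw [h0] at this
    linarith
  have e2 : 0 < ‖besselJ 1 (x + h)‖ := by linarith
  refine ⟨norm_pos_iff.mp e2, ?_⟩
  rw [norm_div (besselJ 0 (x + h)), div_le_iff₀ e2]
  refine e0.trans ?_
  have := mul_le_mul_of_nonneg_left e1 (show 0 ≤ 2 * ‖besselJ 0 x / besselJ 1 x‖ + 4 * ‖h‖ by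
    positivity)
  linarith

/-- The Riccati equation of `J₀ / J₁`. -/
theorem hasDerivAt_besselJ_ratio {z : ℂ} (hz : z ≠ 0) (h1 : besselJ 1 z ≠ 0) :
    HasDerivAt (fun z => besselJ 0 z / besselJ 1 z)
      (-1 - (besselJ 0 z / besselJ 1 z) ^ 2 + besselJ 0 z / besselJ 1 z / z) z := by
  refine ((hasDerivAt_besselJ_zero z).div (hasDerivAt_besselJ_one hz) h1).congr_deriv ?_
  field_simp
  ring

/-! ### Existence and location of the roots -/

/-- A root is a zero of `J₀ / J₁ + 1 / (z - I)`. By the Riccati equation this function has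
derivative `-1 + O(1 / x²)` near `x`, so adding `z` to it gives a contraction of the disk of radius
`5 / x`, whose fixed point is the root. -/
theorem exists_root_near {x : ℝ} (hx : 40 ≤ x) (h1 : besselJ 1 x ≠ 0)
    (hr : ‖besselJ 0 x / besselJ 1 x‖ ≤ 1 / x) :
    ∃ z : ℂ, (Complex.I * z - z ^ 2) * besselJ 0 z + z * deriv (besselJ 0) z = 0 ∧
      ‖z - x - (besselJ 0 x / besselJ 1 x + 1 / (x - Complex.I))‖ ≤ 3000 / x ^ 3 := by
  have hx0 : 0 < x := by linarith
  have hx1 : 1 / x ≤ 1 / 40 := one_div_le_one_div_of_le (by norm_num) hx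
  have hx1' : 0 < 1 / x := by positivity
  have h5x : 5 / x = 5 * (1 / x) := by ring
  have hI : ∀ z : ℂ, ‖z - x‖ ≤ 5 / x → x / 2 ≤ ‖z‖ ∧ x / 2 ≤ ‖z - Complex.I‖ := by
    intro z hz
    have h2 := norm_sub_norm_le (x : ℂ) z
    have h3 := norm_sub_norm_le z Complex.I
    rw [norm_sub_rev, Complex.norm_real, Real.norm_of_nonneg hx0.le] at h2
    rw [Complex.norm_I] at h3
    constructor <;> linarith
  have hq : ∀ z ∈ Metric.closedBall (x : ℂ) (5 / x), besselJ 1 z ≠ 0 ∧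
      ‖besselJ 0 z / besselJ 1 z‖ ≤ 22 / x := by
    intro z hz
    rw [mem_closedBall_iff_norm] at hz
    have h2 := besselJ_ratio_bounds (by linarith) h1 (hr.trans (by linarith)) (h := z - x)
      (by linarith)
    rw [add_sub_cancel] at h2
    refine ⟨h2.1, h2.2.trans ?_⟩
    have : 22 / x = 22 * (1 / x) := by ring
    linarith
  have hd : ∀ z ∈ Metric.closedBall (x : ℂ) (5 / x), HasDerivAt
      (fun z => z + (besselJ 0 z / besselJ 1 z + 1 / (z - Complex.I)))
      (-(besselJ 0 z / besselJ 1 z) ^ 2 + besselJ 0 z / besselJ 1 z / z -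
        1 / (z - Complex.I) ^ 2) z := by
    intro z hz
    obtain ⟨h3, h4⟩ := hI z (mem_closedBall_iff_norm.mp hz)
    have hz0 : z ≠ 0 := norm_pos_iff.mp (by linarith)
    have hzI : z - Complex.I ≠ 0 := norm_pos_iff.mp (by linarith)
    have h5 : HasDerivAt (fun z => 1 / (z - Complex.I)) (-1 / (z - Complex.I) ^ 2) z := by
      simp only [one_div]
      exact ((hasDerivAt_id z).sub_const Complex.I).inv hzI
    refine ((hasDerivAt_id z).add ((hasDerivAt_besselJ_ratio hz0 (hq z hz).1).add
      h5)).congr_deriv ?_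
    ring
  have hbd : ∀ z ∈ Metric.closedBall (x : ℂ) (5 / x),
      ‖-(besselJ 0 z / besselJ 1 z) ^ 2 + besselJ 0 z / besselJ 1 z / z -
        1 / (z - Complex.I) ^ 2‖ ≤ 600 / x ^ 2 := by
    intro z hz
    obtain ⟨h3, h4⟩ := hI z (mem_closedBall_iff_norm.mp hz)
    have h5 := (hq z hz).2
    generalize besselJ 0 z / besselJ 1 z = q at h5
    calc _ ≤ ‖q‖ ^ 2 + ‖q‖ / ‖z‖ + 1 / ‖z - Complex.I‖ ^ 2 := by
          refine (norm_sub_le _ _).trans (add_le_add ((norm_add_le _ _).trans ?_) ?_)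
          · rw [norm_neg, norm_pow, norm_div]
          · rw [norm_div, norm_pow, norm_one]
      _ ≤ (22 / x) ^ 2 + (22 / x) / (x / 2) + 1 / (x / 2) ^ 2 := by gcongr
      _ = 532 / x ^ 2 := by field_simp; norm_num
      _ ≤ 600 / x ^ 2 := by gcongr; norm_num
  obtain ⟨g, hg⟩ : ∃ g : ℂ → ℂ, g = fun z => z + (besselJ 0 z / besselJ 1 z +
    1 / (z - Complex.I)) := ⟨_, rfl⟩
  rw [← hg] at hd
  have hxm : (x : ℂ) ∈ Metric.closedBall (x : ℂ) (5 / x) :=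
    Metric.mem_closedBall_self (by positivity)
  have hlip : ∀ y ∈ Metric.closedBall (x : ℂ) (5 / x), ∀ z ∈ Metric.closedBall (x : ℂ) (5 / x),
      ‖g z - g y‖ ≤ 600 / x ^ 2 * ‖z - y‖ := fun y hy z hz =>
    (convex_closedBall _ _).norm_image_sub_le_of_norm_hasDerivWithin_le
      (fun z hz => (hd z hz).hasDerivWithinAt) hbd hy hz
  have hK : 600 / x ^ 2 ≤ 1 / 2 := by
    rw [div_le_iff₀ (by positivity)]
    nlinarith
  have hgx : ‖g x - x‖ ≤ 2 / x := by
    have e : g x - x = besselJ 0 x / besselJ 1 x + 1 / (x - Complex.I) := by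
      rw [hg]
      ring
    have h2 : x ≤ ‖(x : ℂ) - Complex.I‖ := by
      have := Complex.re_le_norm ((x : ℂ) - Complex.I)
      simpa using this
    rw [e]
    calc _ ≤ 1 / x + 1 / x := by
          refine (norm_add_le _ _).trans (add_le_add hr ?_)
          rw [norm_div, norm_one]
          gcongr
      _ = 2 / x := by ring
  have hmaps : Set.MapsTo g (Metric.closedBall (x : ℂ) (5 / x))
      (Metric.closedBall (x : ℂ) (5 / x)) := by
    intro z hz
    have h2 := hlip x hxm z hz
    rw [mem_closedBall_iff_norm] at hz ⊢
    have h3 : 600 / x ^ 2 * ‖z - x‖ ≤ 1 / 2 * (5 / x) := by gcongr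
    have h4 := norm_sub_le_norm_sub_add_norm_sub (g z) (g x) (x : ℂ)
    have h2x : 2 / x = 2 * (1 / x) := by ring
    linarith
  have hcontr : ContractingWith (1 / 2) hmaps.restrict := by
    refine ⟨by norm_num, LipschitzWith.of_dist_le_mul fun y z => ?_⟩
    have h2 := hlip z z.2 y y.2
    rw [Subtype.dist_eq, Subtype.dist_eq, dist_eq_norm, dist_eq_norm]
    refine h2.trans ?_
    push_cast
    gcongr
  obtain ⟨z, hz, hfix, -⟩ := hcontr.exists_fixedPoint' Metric.isClosed_closedBall.isComplete hmaps
    hxm (edist_ne_top _ _)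
  have hgz : g z = z := hfix
  refine ⟨z, ?_, ?_⟩
  · have hzI : z - Complex.I ≠ 0 :=
      norm_pos_iff.mp (by linarith [(hI z (mem_closedBall_iff_norm.mp hz)).2])
    have hJ := (hq z hz).1
    rw [(hasDerivAt_besselJ_zero z).deriv]
    rw [hg] at hgz
    have h2 : besselJ 0 z / besselJ 1 z + 1 / (z - Complex.I) = 0 := by
      linear_combination hgz
    field_simp at h2
    linear_combination (-z) * h2
  · have e : z - x - (besselJ 0 x / besselJ 1 x + 1 / (x - Complex.I)) = g z - g x := by
      rw [hgz, hg]
      ring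
    rw [e]
    calc _ ≤ 600 / x ^ 2 * (5 / x) :=
          (hlip x hxm z hz).trans (by gcongr; exact mem_closedBall_iff_norm.mp hz)
      _ = 3000 / x ^ 3 := by field_simp; norm_num

/-- The roots near `kπ - π / 4`, with the constant of the error term independent of `k`. -/
theorem exists_root_eventually :
    ∃ C : ℝ, ∀ᶠ k : ℕ in atTop, ∃ z : ℂ,
      (Complex.I * z - z ^ 2) * besselJ 0 z + z * deriv (besselJ 0) z = 0 ∧
      ‖z - (((k : ℂ) * (Real.pi : ℂ) - (Real.pi : ℂ) / 4) +
            1 / (8 * ((k : ℂ) * (Real.pi : ℂ) - (Real.pi : ℂ) / 4)) +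
            ((k : ℂ) * (Real.pi : ℂ) - (Real.pi : ℂ) / 4) /
              (1 + ((k : ℂ) * (Real.pi : ℂ) - (Real.pi : ℂ) / 4) ^ 2) +
            Complex.I / (1 + ((k : ℂ) * (Real.pi : ℂ) - (Real.pi : ℂ) / 4) ^ 2))‖ ≤
        C * (1 / (k : ℝ) ^ 3) := by
  obtain ⟨c, hc, hlow⟩ := exists_le_sq_mul_besselJ_sq
  refine ⟨3000 + (2000 / c + 2), ?_⟩
  have hbig : ∀ᶠ x : ℝ in atTop, 40 ≤ x ∧ 584 / c ≤ x ∧ 2 * (2000 / c + 2) ≤ x :=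
    (eventually_ge_atTop 40).and ((eventually_ge_atTop _).and (eventually_ge_atTop _))
  have htend : Tendsto (fun k : ℕ => (k : ℝ) * Real.pi - Real.pi / 4) atTop atTop :=
    tendsto_atTop_add_const_right _ _ (tendsto_natCast_atTop_atTop.atTop_mul_const Real.pi_pos)
  filter_upwards [htend.eventually hbig, eventually_ge_atTop 1] with k ⟨hx40, hxc, hxr⟩ hk
  obtain ⟨x, hx⟩ : ∃ x : ℝ, x = k * Real.pi - Real.pi / 4 := ⟨_, rfl⟩
  have hxC : (k : ℂ) * (Real.pi : ℂ) - (Real.pi : ℂ) / 4 = x := by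
    rw [hx]
    push_cast
    rfl
  rw [← hx] at hx40 hxc hxr
  rw [hxC]
  have hk1 : (1 : ℝ) ≤ k := by exact_mod_cast hk
  have hkx : (k : ℝ) ≤ x := by
    rw [hx]
    nlinarith [Real.pi_gt_three]
  have hx0 : 0 < x := by linarith
  obtain ⟨hb, hr⟩ := abs_div_sub_le_of_relation hc (by linarith) (by nlinarith)
    (hlow x (by linarith)) (abs_bessel_relation_le hx (by linarith))
  have hJ : besselJ 1 (x : ℂ) ≠ 0 := by
    rw [← besselJ_ofReal]
    exact Complex.ofReal_ne_zero.mpr hb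
  have hr' : ‖besselJ 0 (x : ℂ) / besselJ 1 x - 1 / (8 * x)‖ ≤ (2000 / c + 2) / x ^ 3 := by
    rw [← besselJ_ofReal 0, ← besselJ_ofReal 1]
    exact_mod_cast hr
  have hr1 : ‖besselJ 0 (x : ℂ) / besselJ 1 x‖ ≤ 1 / x := by
    have h2 := norm_sub_norm_le (besselJ 0 (x : ℂ) / besselJ 1 x) (1 / (8 * x))
    have h3 : ‖(1 / (8 * x) : ℂ)‖ = 1 / 8 * (1 / x) := by
      simp [abs_of_pos hx0]
      ring
    have h4 : (2000 / c + 2) / x ^ 3 ≤ 1 / 2 * (1 / x) := by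
      rw [div_le_iff₀ (by positivity)]
      have e : 1 / 2 * (1 / x) * x ^ 3 = x * x / 2 := by field_simp
      rw [e]
      nlinarith
    have : 0 < 1 / x := by positivity
    linarith
  obtain ⟨z, hz, hzx⟩ := exists_root_near hx40 hJ hr1
  refine ⟨z, hz, ?_⟩
  have hxI : (x : ℂ) - Complex.I ≠ 0 := by
    intro h
    have := congrArg Complex.re h
    simp at this
    linarith
  have hxx : (1 + (x : ℂ) ^ 2) ≠ 0 := by
    norm_cast
    positivity
  have hsplit :
      1 / ((x : ℂ) - Complex.I) = x / (1 + (x : ℂ) ^ 2) + Complex.I / (1 + (x : ℂ) ^ 2) := by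
    rw [← add_div, div_eq_div_iff hxI hxx]
    linear_combination Complex.I_sq
  rw [hsplit] at hzx
  have e : z - (x + 1 / (8 * x) + x / (1 + (x : ℂ) ^ 2) + Complex.I / (1 + (x : ℂ) ^ 2)) =
      (z - x - (besselJ 0 x / besselJ 1 x +
        (x / (1 + (x : ℂ) ^ 2) + Complex.I / (1 + (x : ℂ) ^ 2)))) +
      (besselJ 0 (x : ℂ) / besselJ 1 x - 1 / (8 * x)) := by ring
  rw [e]
  calc _ ≤ 3000 / x ^ 3 + (2000 / c + 2) / x ^ 3 := (norm_add_le _ _).trans (add_le_add hzx hr')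
    _ = (3000 + (2000 / c + 2)) * (1 / x ^ 3) := by ring
    _ ≤ (3000 + (2000 / c + 2)) * (1 / (k : ℝ) ^ 3) := by gcongr

theorem mainTheorem4 :
    ∃ l : ℕ → ℂ,
      (∀ᶠ k : ℕ in atTop,
        (Complex.I * l k - l k ^ 2) * besselJ 0 (l k) + l k * deriv (besselJ 0) (l k) = 0) ∧
      (fun k : ℕ =>
        l k -
          (((k : ℂ) * (Real.pi : ℂ) - (Real.pi : ℂ) / 4) +
            1 / (8 * ((k : ℂ) * (Real.pi : ℂ) - (Real.pi : ℂ) / 4)) +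
            ((k : ℂ) * (Real.pi : ℂ) - (Real.pi : ℂ) / 4) /
              (1 + ((k : ℂ) * (Real.pi : ℂ) - (Real.pi : ℂ) / 4) ^ 2) +
            Complex.I / (1 + ((k : ℂ) * (Real.pi : ℂ) - (Real.pi : ℂ) / 4) ^ 2)))
        =O[atTop] (fun k : ℕ => 1 / (k : ℝ) ^ 3) := by
  obtain ⟨C, hC⟩ := exists_root_eventually
  obtain ⟨l, hl⟩ := hC.choice
  refine ⟨l, hl.mono fun k hk => hk.1, IsBigO.of_bound C (hl.mono fun k hk => ?_)⟩
  rw [Real.norm_of_nonneg (show (0 : ℝ) ≤ 1 / (k : ℝ) ^ 3 by positivity)]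
  exact hk.2
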